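/- Let $K$ be a field, $m,n\ge 0$, and let $R=K[x_0,\dots,x_m,y_0,\dots,y_n]$ be bigraded by $\deg x_i=(1,0)$, $\deg y_j=(0,1)$. For a bigraded $R$-module $M=\bigoplus_{(a,b)\in\mathbb Z^2}M_{a,b}$, let $M^{\sharp}$ be $M$ with the total grading $M^\sharp_t=\bigoplus_{a+b=t}M_{a,b}$, and for an ideal $I$ generated by some of the variables let $H^i_I(M)$ be the $i$-th local cohomology module with its induced (bi)grading, that is, the $i$-th cohomology of the Čech complex of $M$ on these variables. For integers $d\ge 0$ and $p,p'$, the module $M$ is said to satisfy $VC_d(p,p')$ if for all $i\ge 0$ \begin{align*} H^i_{(x)}(M)_{k,k'}&=0 \quad\text{for all } k\ge p+d+1-i \text{ and all } k'\in\mathbb Z,\\ H^i_{(y)}(M)_{k,k'}&=0 \quad\text{for all } k'\ge p'+d+1-i \text{ and all } k\in\mathbb Z,\\ H^i_{(x,y)}(M^\sharp)_{t}&=0 \quad\text{for all } t\ge p+p'+d+1-i, \end{align*} where $(x)=(x_0,\dots,x_m)$, $(y)=(y_0,\dots,y_n)$ and $(x,y)=(x_0,\dots,x_m,y_0,\dots,y_n)$.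 Let \[ DReg_d(p,p')=\{(a,b)\in\mathbb Z^2: a,b\le 0\}+(p,p')+\{(r,s)\in\mathbb Z^2: r+s=d,\ r,s\ge 0\}, \] which is the set of all $(k,k')\in\mathbb Z^2$ with $k\le p+d$, $k'\le p'+d$ and $k+k'\le p+p'+d$. If a finitely generated bigraded $R$-module $M$ satisfies $VC_d(p,p')$, then $M$ is generated as an $R$-module by homogeneous elements whose bidegrees lie in $DReg_d(p,p')$. -/

import Mathlib

noncomputable section

namespace BigradedRegularity

open scoped Pointwise

/-! ### Local cohomology through the Cech complex

Let `R` be a commutative ring, `M` an `R`-module and `f : ι → R` a finite family, indexed by a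
linear order. For a finite set `S` of indices put `f_S = ∏ j ∈ S, f j`. The Cech complex of `M` is
`0 → M → ∏_j M_{f_j} → ∏_{j < k} M_{f_j f_k} → ⋯`, with `∏_{#S = i} M_{f_S}` in degree `i`; for
Noetherian `R` its `i`-th cohomology is the local cohomology module `H^i_I(M)`, where `I` is the
ideal generated by the family. -/

section Cech

variable {R : Type*} [CommRing R] {ι : Type*} [LinearOrder ι] (f : ι → R)
variable (M : Type*) [AddCommGroup M] [Module R M]

/-- The product `f_S` of the members of the family with index in `S`. -/
def famProd (S : Finset ι) : R := ∏ j ∈ S, f j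

/-- The localization `M_{f_S}`. -/
abbrev CechLoc (S : Finset ι) : Type _ :=
  LocalizedModule (Submonoid.powers (famProd f S)) M

/-- For `T ⊆ S` the powers of `f_T` act invertibly on `M_{f_S}`. -/
theorem isUnit_powers {T S : Finset ι} (h : T ⊆ S) (a : Submonoid.powers (famProd f T)) :
    IsUnit (algebraMap R (Module.End R (CechLoc f M S)) a) := by
  obtain ⟨_, k, rfl⟩ := a
  have h1 : famProd f S = famProd f T * ∏ j ∈ S \ T, f j := by
    rw [famProd, famProd, mul_comm, Finset.prod_sdiff h]
  have h2 : IsUnit (algebraMap R (Module.End R (CechLoc f M S)) (famProd f S)) :=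
    IsLocalizedModule.map_units (LocalizedModule.mkLinearMap (Submonoid.powers (famProd f S)) M)
      ⟨famProd f S, Submonoid.mem_powers _⟩
  have h3 := (congrArg (algebraMap R (Module.End R (CechLoc f M S))) h1).trans (map_mul _ _ _)
  have h4 := (Commute.isUnit_mul_iff (Algebra.commute_algebraMap_left _ _)).1 (h3 ▸ h2)
  exact (map_pow (algebraMap R (Module.End R (CechLoc f M S))) (famProd f T) k).symm ▸ h4.1.pow k

/-- The canonical map `M_{f_T} → M_{f_S}` for `T ⊆ S`. -/
def cechRes {T S : Finset ι} (h : T ⊆ S) : CechLoc f M T →ₗ[R] CechLoc f M S :=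
  LocalizedModule.lift (Submonoid.powers (famProd f T))
    (LocalizedModule.mkLinearMap (Submonoid.powers (famProd f S)) M) (isUnit_powers f M h)

/-- Cech cochains of degree `i`. -/
abbrev CechCochain (i : ℕ) : Type _ :=
  (S : {S : Finset ι // S.card = i}) → CechLoc f M S.1

/-- The Cech differential
`(d c)_S = ∑_{j ∈ S} (-1)^{#{k ∈ S : k < j}} c_{S \ {j}}|_{M_{f_S}}`. -/
def cechD (i : ℕ) : CechCochain f M i →ₗ[R] CechCochain f M (i + 1) :=
  LinearMap.pi fun S => ∑ j : {j // j ∈ S.1},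
    (-1 : R) ^ (S.1.filter (· < j.1)).card •
      (cechRes f M (Finset.erase_subset j.1 S.1)) ∘ₗ
        LinearMap.proj (⟨S.1.erase j.1, by
          rw [Finset.card_erase_of_mem j.2, S.2, Nat.add_sub_cancel]⟩ :
            {S : Finset ι // S.card = i})

/-- Cech cocycles of degree `i`. -/
def cechCocycles (i : ℕ) : Submodule R (CechCochain f M i) := LinearMap.ker (cechD f M i)

/-- Cech coboundaries of degree `i`. -/
def cechCoboundaries : (i : ℕ) → Submodule R (CechCochain f M i)
  | 0 => ⊥
  | i + 1 => LinearMap.range (cechD f M i)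

/-- The local cohomology module `H^i_I(M)`, `I` the ideal generated by the family `f`. -/
abbrev LocalCohomology (i : ℕ) : Type _ :=
  cechCocycles f M i ⧸ (cechCoboundaries f M i).submoduleOf (cechCocycles f M i)

variable {M}
variable {γ : Type*} [AddCommGroup γ] (e : ι → γ) (ℳ : γ → AddSubgroup M)

/-- The homogeneous part of degree `g` of `M_{f_S}`, where `M` is graded by `ℳ` and `f j` is
homogeneous of degree `e j`: it consists of the fractions `x / f_S ^ N` with `x` homogeneous of
degree `g + N • deg f_S`. (For a graded module these fractions already form a subgroup.) -/
def locPart (S : Finset ι) (g : γ) : AddSubgroup (CechLoc f M S) :=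
  AddSubgroup.closure {z | ∃ (N : ℕ) (x : M), x ∈ ℳ (g + N • ∑ j ∈ S, e j) ∧
    z = LocalizedModule.mk x (Submonoid.pow (famProd f S) N)}

/-- The Cech cochains of degree `i` that are homogeneous of degree `g`. -/
def cochainPart (i : ℕ) (g : γ) : AddSubgroup (CechCochain f M i) :=
  AddSubgroup.pi Set.univ fun S => locPart f e ℳ S.1 g

/-- The homogeneous part `H^i_I(M)_g` of degree `g` of local cohomology: the classes of the
homogeneous cocycles of degree `g`. -/
def localCohomologyPart (i : ℕ) (g : γ) : AddSubgroup (LocalCohomology f M i) :=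
  ((cochainPart f e ℳ i g).comap (cechCocycles f M i).subtype.toAddMonoidHom).map
    (Submodule.mkQ ((cechCoboundaries f M i).submoduleOf (cechCocycles f M i))).toAddMonoidHom

end Cech

/-! ### Bigraded modules over `K[x_0, …, x_m, y_0, …, y_n]` -/

/-- The polynomial ring `K[x_0, …, x_m, y_0, …, y_n]`. -/
abbrev BiPoly (K : Type*) [Field K] (m n : ℕ) : Type _ :=
  MvPolynomial (Fin (m + 1) ⊕ Fin (n + 1)) K

/-- The bidegrees of the variables: `(1, 0)` for each `x_i` and `(0, 1)` for each `y_j`. -/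
def varDeg (m n : ℕ) : Fin (m + 1) ⊕ Fin (n + 1) → ℤ × ℤ :=
  Sum.elim (fun _ => (1, 0)) (fun _ => (0, 1))

/-- The homogeneous part `R_{a, b}` of the polynomial ring `R`, for `(a, b) ∈ ℤ²`. -/
abbrev polyPart (K : Type*) [Field K] (m n : ℕ) : ℤ × ℤ → Submodule K (BiPoly K m n) :=
  MvPolynomial.weightedHomogeneousSubmodule K (varDeg m n)

/-- The generators `x_0, …, x_m` of the ideal `(x)`. -/
def xVars (K : Type*) [Field K] (m n : ℕ) : Fin (m + 1) → BiPoly K m n :=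
  fun i => MvPolynomial.X (Sum.inl i)

/-- The generators `y_0, …, y_n` of the ideal `(y)`. -/
def yVars (K : Type*) [Field K] (m n : ℕ) : Fin (n + 1) → BiPoly K m n :=
  fun j => MvPolynomial.X (Sum.inr j)

/-- The generators `x_0, …, x_m, y_0, …, y_n` of the ideal `(x, y)`. -/
def xyVars (K : Type*) [Field K] (m n : ℕ) : Fin (m + 1) ⊕ₗ Fin (n + 1) → BiPoly K m n :=
  fun v => MvPolynomial.X (ofLex v)

/-- The total grading `M^♯_t = ⨁_{a + b = t} M_{a, b}` of a bigraded module. -/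
def sharp {M : Type*} [AddCommGroup M] (ℳ : ℤ × ℤ → AddSubgroup M) (t : ℤ) : AddSubgroup M :=
  ⨆ g : {g : ℤ × ℤ // g.1 + g.2 = t}, ℳ g.1

/-- The vanishing condition `VC_d(p, p')` for a bigraded `R`-module `M = ⨁ M_{a, b}`: for all
`i ≥ 0`,
* `H^i_{(x)}(M)_{k, k'} = 0` for all `k ≥ p + d + 1 - i` and all `k'`;
* `H^i_{(y)}(M)_{k, k'} = 0` for all `k' ≥ p' + d + 1 - i` and all `k`;
* `H^i_{(x, y)}(M^♯)_t = 0` for all `t ≥ p + p' + d + 1 - i`. -/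
structure VC {K : Type*} [Field K] {m n : ℕ} {M : Type*} [AddCommGroup M]
    [Module (BiPoly K m n) M] (ℳ : ℤ × ℤ → AddSubgroup M) (d : ℕ) (p p' : ℤ) : Prop where
  x_vanish : ∀ (i : ℕ) (k k' : ℤ), p + d + 1 - i ≤ k →
    localCohomologyPart (xVars K m n) (fun _ => ((1, 0) : ℤ × ℤ)) ℳ i (k, k') = ⊥
  y_vanish : ∀ (i : ℕ) (k k' : ℤ), p' + d + 1 - i ≤ k' →
    localCohomologyPart (yVars K m n) (fun _ => ((0, 1) : ℤ × ℤ)) ℳ i (k, k') = ⊥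
  xy_vanish : ∀ (i : ℕ) (t : ℤ), p + p' + d + 1 - i ≤ t →
    localCohomologyPart (xyVars K m n) (fun _ => (1 : ℤ)) (sharp ℳ) i t = ⊥

/-- The staircase `{(r, s) : r + s = d, r ≥ 0, s ≥ 0}`. -/
def stair (d : ℕ) : Set (ℤ × ℤ) := {a | a.1 + a.2 = d ∧ 0 ≤ a.1 ∧ 0 ≤ a.2}

/-- The region `DReg_d(p, p') = ℤ_-² + ((p, p') + stair d)`, where `ℤ_-² = {(a, b) : a, b ≤ 0}`. -/
def DReg (d : ℕ) (p p' : ℤ) : Set (ℤ × ℤ) := Set.Iic (0, 0) + ((p, p') +ᵥ stair d)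

theorem mem_DReg_iff (d : ℕ) (p p' k k' : ℤ) :
    (k, k') ∈ DReg d p p' ↔ k ≤ p + d ∧ k' ≤ p' + d ∧ k + k' ≤ p + p' + d := by
  simp only [DReg, stair, Set.mem_add, Set.mem_vadd_set, Set.mem_Iic, Set.mem_ofPred_eq,
    Prod.exists, Prod.mk_le_mk, vadd_eq_add, Prod.mk_add_mk, Prod.mk.injEq]
  constructor
  · rintro ⟨a, b, ⟨ha, hb⟩, u, v, ⟨r, s, ⟨h1, h2, h3⟩, h4, h5⟩, h6, h7⟩
    omega
  · rintro ⟨h1, h2, h3⟩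
    by_cases h : k ≤ p
    · exact ⟨k - p, k' - p' - d, by omega, p, p' + d, ⟨0, d, by omega, by omega, by omega⟩,
        by omega, by omega⟩
    · exact ⟨0, k' - p' - (d - (k - p)), by omega, k, p' + (d - (k - p)),
        ⟨k - p, d - (k - p), by omega, by omega, by omega⟩, by omega, by omega⟩

end BigradedRegularity

end

/-! The key fact concerns a graded module and elements `f j` of one degree ε generating an ideal
`I`. If `H^i_I(M)` vanishes in degree `g - i ε` for all `i`, then `M_g = ∑ f j M_{g-ε}`
(`exists_eq_sum_smul_of_localCohomologyPart_eq_bot`).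

This is a chase in the double complex formed by the Čech complex and a Koszul complex of `f`. On
each `M_{f_S}` with `S` nonempty some `f j` is invertible, so the Koszul direction is exact there
(`exists_koszulD_eq`). The vanishing of cohomology supplies homogeneous primitives in the Čech
direction. The zigzag from `x ∈ M_g` ends because the Čech complex is bounded, and going back down
it writes `x` as a Koszul boundary (`exists_koszulD_sub_cocycle`). Koszul chains are functions on
all words rather than alternating ones: only exactness and the boundary in degree 0 matter.

A bidegree outside `DReg_d(p, p')` violates one of its three defining inequalities, and the
corresponding condition of `VC_d(p, p')` is precisely the required vanishing, for `(x)`, `(y)` or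
`(x, y)` (`VC.mem_of_notMem_DReg`). Elements of such bidegrees therefore come from total degree one
lower. As `M` is finitely generated, its total degrees are bounded below, and induction on the total
degree finishes the proof. -/

noncomputable section

namespace BigradedRegularity

/-! ### A Koszul complex on words -/

section Koszul

variable {R : Type*} [CommRing R] {ι : Type*} [Fintype ι] (f : ι → R)
variable {N : Type*} [AddCommGroup N] [Module R N]

/-- The differential of the non-alternating Koszul complex of `f` with coefficients in `N`: a chain
is a function of words in `ι`, and this is the value of its boundary at the word `t`. -/
def koszulD : List ι → (List ι → N) →ₗ[R] N
  | [] => ∑ j, f j • LinearMap.proj [j]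
  | k :: t => ∑ j, f j • LinearMap.proj (j :: k :: t) -
      koszulD t ∘ₗ LinearMap.funLeft R N (fun s => k :: s)

theorem koszulD_nil (a : List ι → N) : koszulD f [] a = ∑ j, f j • a [j] := by
  simp [koszulD]

theorem koszulD_cons (k : ι) (t : List ι) (a : List ι → N) :
    koszulD f (k :: t) a =
      ∑ j, f j • a (j :: k :: t) - koszulD f t (fun s => a (k :: s)) := by
  simp [koszulD, LinearMap.funLeft, Function.comp_def]

/-- Applied to the Čech differential, this makes the two directions of the double complex commute.
-/
theorem koszulD_map {N' : Type*} [AddCommGroup N'] [Module R N'] (φ : N →ₗ[R] N') (t : List ι)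
    (a : List ι → N) : koszulD f t (fun s => φ (a s)) = φ (koszulD f t a) := by
  induction t generalizing a with
  | nil => simp [koszulD_nil, map_sum]
  | cons k t ih => simp [koszulD_cons, map_sum, ih]

theorem sum_smul_swap (b : ι → ι → N) :
    ∑ j, f j • ∑ k, f k • b k j = ∑ j, f j • ∑ k, f k • b j k := by
  simp only [Finset.smul_sum]
  rw [Finset.sum_comm]
  exact Finset.sum_congr rfl fun j _ => Finset.sum_congr rfl fun k _ => smul_comm _ _ _

/-- The boundary inserts a letter at every position, with alternating sign. Two insertions at the
front cancel by symmetry of the double sum, a front and an inner insertion cancel by sign, and two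
inner ones cancel by induction. -/
theorem koszulD_koszulD (t : List ι) (a : List ι → N) :
    koszulD f t (fun s => koszulD f s a) = 0 := by
  induction t generalizing a with
  | nil =>
    simp only [koszulD_nil, koszulD_cons, smul_sub, Finset.sum_sub_distrib]
    rw [sum_smul_swap f (fun k j => a [k, j]), sub_self]
  | cons k t ih =>
    have h1 : koszulD f t (fun s => koszulD f (k :: s) a) =
        ∑ j, f j • koszulD f t (fun s => a (j :: k :: s)) := by
      have h2 : (fun s => koszulD f (k :: s) a) =
          ∑ j, f j • (fun s => a (j :: k :: s)) - fun s => koszulD f s (fun r => a (k :: r)) := by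
        ext s
        simp [koszulD_cons]
      rw [h2, map_sub, ih, sub_zero, map_sum]
      simp
    rw [koszulD_cons, h1]
    simp only [koszulD_cons f _ (k :: t), koszulD_cons f k t, smul_sub, Finset.sum_sub_distrib]
    rw [sum_smul_swap f (fun l j => a (l :: j :: k :: t))]
    abel

theorem koszulD_mem {A B : AddSubgroup N} (hAB : ∀ j, ∀ x ∈ A, f j • x ∈ B) (t : List ι)
    (a : List ι → N) (ha : ∀ s, s.length = t.length + 1 → a s ∈ A) : koszulD f t a ∈ B := by
  induction t generalizing a with
  | nil =>
    rw [koszulD_nil]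
    exact B.sum_mem fun j _ => hAB j _ (ha _ rfl)
  | cons k t ih =>
    rw [koszulD_cons]
    refine B.sub_mem (B.sum_mem fun j _ => hAB j _ (ha _ rfl)) (ih _ fun s hs => ha _ ?_)
    simp [hs]

theorem koszulD_congr (t : List ι) {a b : List ι → N}
    (h : ∀ s, s.length = t.length + 1 → a s = b s) : koszulD f t a = koszulD f t b := by
  rw [← sub_eq_zero, ← map_sub]
  -- With both subgroups zero, `koszulD_mem` says that a chain vanishing on words of length
  -- `t.length + 1` has zero boundary at `t`.
  exact (AddSubgroup.mem_bot).1 (koszulD_mem f (A := ⊥) (B := ⊥) (by simp) t _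
    (fun s hs => by simp [h s hs]))

open Classical in
/-- The contracting homotopy of the Koszul complex given by an inverse `u` of `f j₀`. -/
def koszulH (j₀ : ι) (u : N →ₗ[R] N) (a : List ι → N) : List ι → N
  | [] => 0
  | k :: t => if k = j₀ then u (a t) else 0

/-- Inserting a letter at the front of the homotopy returns `f j₀ • u (a t) = a t`; the other
insertions pass through the linear map `u`. The homotopy is 0 at the empty word, so the identity
includes surjectivity of the boundary onto degree 0. -/
theorem koszulD_koszulH {j₀ : ι} {u : N →ₗ[R] N} (hu : ∀ x, f j₀ • u x = x) (t : List ι)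
    (a : List ι → N) :
    koszulD f t (koszulH j₀ u a) = a t - koszulH j₀ u (fun s => koszulD f s a) t := by
  have key : ∀ s, ∑ j, f j • koszulH j₀ u a (j :: s) = a s := fun s => by
    rw [Finset.sum_eq_single j₀ (fun j _ hj => by simp [koszulH, hj]) (by simp)]
    simp [koszulH, hu]
  cases t with
  | nil => rw [koszulD_nil, key]; simp [koszulH]
  | cons k t =>
    rw [koszulD_cons, key]
    by_cases hk : k = j₀
    · simp [koszulH, hk, koszulD_map]
    · have h0 : (fun s => koszulH j₀ u a (k :: s)) = 0 := by ext s; simp [koszulH, hk]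
      rw [h0, map_zero]
      simp [koszulH, hk]

end Koszul

/-! ### The Cech complex -/

section CechComplex

variable {R : Type*} [CommRing R] {ι : Type*} (f : ι → R)
variable {M : Type*} [AddCommGroup M] [Module R M]

/-- The fraction `x / f_S ^ N` in `M_{f_S}`. -/
abbrev cechFrac (S : Finset ι) (N : ℕ) (x : M) : CechLoc f M S :=
  LocalizedModule.mk x (Submonoid.pow (famProd f S) N)

theorem exists_cechFrac {S : Finset ι} (z : CechLoc f M S) : ∃ N x, z = cechFrac f S N x := by
  induction z using LocalizedModule.induction_on with
  | h x s =>
    obtain ⟨_, N, rfl⟩ := s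
    exact ⟨N, x, rfl⟩

theorem cechFrac_eq_iff {S : Finset ι} {N N' : ℕ} {x y : M} :
    cechFrac f S N x = cechFrac f S N' y ↔
      ∃ c, famProd f S ^ (c + N') • x = famProd f S ^ (c + N) • y := by
  rw [cechFrac, cechFrac, LocalizedModule.mk_eq]
  constructor
  · rintro ⟨⟨_, c, rfl⟩, h⟩
    refine ⟨c, ?_⟩
    rw [pow_add, pow_add, mul_smul, mul_smul]
    exact h
  · rintro ⟨c, h⟩
    refine ⟨Submonoid.pow _ c, ?_⟩
    rw [pow_add, pow_add, mul_smul, mul_smul] at h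
    exact h

theorem smul_cechFrac (S : Finset ι) (N : ℕ) (r : R) (x : M) :
    r • cechFrac f S N x = cechFrac f S N (r • x) :=
  LocalizedModule.smul'_mk r x _

theorem cechFrac_zero (S : Finset ι) (x : M) : cechFrac f S 0 x =
    LocalizedModule.mkLinearMap (Submonoid.powers (famProd f S)) M x := by
  rw [LocalizedModule.mkLinearMap_apply, cechFrac]
  exact congrArg _ (Subtype.ext (pow_zero _))

theorem pow_smul_cechFrac (S : Finset ι) (N : ℕ) (x : M) :
    famProd f S ^ N • cechFrac f S N x = cechFrac f S 0 x := by
  rw [smul_cechFrac, cechFrac_eq_iff]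
  exact ⟨0, by simp⟩

variable [LinearOrder ι]

theorem famProd_sdiff {T S : Finset ι} (h : T ⊆ S) :
    famProd f S = famProd f T * famProd f (S \ T) := by
  rw [famProd, famProd, famProd, mul_comm, Finset.prod_sdiff h]

theorem cechRes_cechFrac_zero {T S : Finset ι} (h : T ⊆ S) (x : M) :
    cechRes f M h (cechFrac f T 0 x) = cechFrac f S 0 x := by
  rw [cechFrac_zero, cechFrac_zero]
  exact DFunLike.congr_fun (LocalizedModule.lift_comp _ _ (isUnit_powers f M h)) x

/-- Multiplication by `f_T ^ N` is injective on `M_{f_S}`, so it suffices to compare after clearing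
the denominator, where `f_T f_{S \ T} = f_S`. -/
theorem cechRes_cechFrac {T S : Finset ι} (h : T ⊆ S) (N : ℕ) (x : M) :
    cechRes f M h (cechFrac f T N x) = cechFrac f S N (famProd f (S \ T) ^ N • x) := by
  have hu := isUnit_powers f M h (Submonoid.pow _ N)
  apply ((Module.End.isUnit_iff _).1 hu).1
  have hp : ((Submonoid.pow (famProd f T) N : Submonoid.powers (famProd f T)) : R) =
    famProd f T ^ N := rfl
  rw [Module.algebraMap_end_apply, Module.algebraMap_end_apply, hp, ← map_smul,
    pow_smul_cechFrac, cechRes_cechFrac_zero, smul_cechFrac, smul_smul, ← mul_pow,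
    ← famProd_sdiff f h, ← smul_cechFrac, pow_smul_cechFrac]

theorem cechRes_cechRes {T S U : Finset ι} (h : T ⊆ S) (h' : S ⊆ U) (z : CechLoc f M T) :
    cechRes f M h' (cechRes f M h z) = cechRes f M (h.trans h') z := by
  obtain ⟨N, x, rfl⟩ := exists_cechFrac f z
  rw [cechRes_cechFrac, cechRes_cechFrac, cechRes_cechFrac, smul_smul, ← mul_pow]
  congr 3
  rw [famProd, famProd, famProd, ← Finset.prod_union]
  · congr 1
    ext a
    have := @h a
    have := @h' a
    simp only [Finset.mem_union, Finset.mem_sdiff]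
    tauto
  · rw [Finset.disjoint_left]
    intro a
    simp only [Finset.mem_sdiff]
    tauto

theorem cechD_apply (i : ℕ) (c : CechCochain f M i) (S : {S : Finset ι // S.card = i + 1}) :
    cechD f M i c S = ∑ j : {j // j ∈ S.1}, (-1 : R) ^ (S.1.filter (· < j.1)).card •
      cechRes f M (Finset.erase_subset j.1 S.1) (c ⟨S.1.erase j.1, by
          rw [Finset.card_erase_of_mem j.2, S.2, Nat.add_sub_cancel]⟩) := by
  simp [cechD, LinearMap.sum_apply]

theorem card_filter_erase_of_lt {S : Finset ι} {j k : ι} (hk : k ∈ S) (hkj : k < j) :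
    (S.filter (· < j)).card = ((S.erase k).filter (· < j)).card + 1 := by
  rw [Finset.filter_erase, Finset.card_erase_add_one]
  simp [hk, hkj]

theorem card_filter_erase_of_le {S : Finset ι} {j k : ι} (hkj : j ≤ k) :
    ((S.erase k).filter (· < j)).card = (S.filter (· < j)).card := by
  rw [Finset.filter_erase, Finset.erase_eq_of_notMem]
  simp [hkj]

/-- Removing `j` then `k` cancels against removing `k` then `j`: removing the smaller index first
lowers the position of the larger one by one, which flips the sign. -/
theorem cechD_cechD (i : ℕ) (c : CechCochain f M i) : cechD f M (i + 1) (cechD f M i c) = 0 := by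
  ext S
  rw [cechD_apply]
  simp only [cechD_apply, map_sum, map_smul, Finset.smul_sum, cechRes_cechRes, smul_smul,
    ← pow_add]
  rw [Finset.sum_sigma']
  refine Finset.sum_involution
    (fun a _ => ⟨⟨a.2.1, Finset.mem_of_mem_erase a.2.2⟩, ⟨a.1.1, Finset.mem_erase.2
      ⟨fun h => Finset.ne_of_mem_erase a.2.2 h.symm, a.1.2⟩⟩⟩) ?_ ?_ ?_ ?_
  · rintro ⟨⟨j, hj⟩, ⟨k, hk⟩⟩ -
    dsimp only
    have hkS := Finset.mem_of_mem_erase hk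
    have hne := Finset.ne_of_mem_erase hk
    have hc : ∀ (T T' : Finset ι) (hT : T.card = i) (hT' : T'.card = i) (h : T ⊆ S.1)
        (h' : T' ⊆ S.1), T = T' → cechRes f M h (c ⟨T, hT⟩) = cechRes f M h' (c ⟨T', hT'⟩) := by
      rintro T _ _ _ _ _ rfl
      rfl
    rw [hc _ ((S.1.erase k).erase j) _ (by
      rw [Finset.card_erase_of_mem (Finset.mem_erase.2 ⟨hne.symm, hj⟩),
        Finset.card_erase_of_mem hkS, S.2]; omega) _
      ((Finset.erase_subset _ _).trans (Finset.erase_subset _ _)) Finset.erase_right_comm,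
      ← add_smul]
    rcases lt_or_gt_of_ne hne with h | h
    · rw [card_filter_erase_of_lt hkS h, card_filter_erase_of_le h.le]
      convert zero_smul R _ using 2
      ring
    · rw [card_filter_erase_of_lt hj h, card_filter_erase_of_le h.le]
      convert zero_smul R _ using 2
      ring
  · rintro ⟨⟨j, hj⟩, ⟨k, hk⟩⟩ - - h
    simp only [Sigma.mk.injEq, Subtype.mk.injEq] at h
    exact Finset.ne_of_mem_erase hk h.1
  · simp
  · rintro ⟨⟨j, hj⟩, ⟨k, hk⟩⟩ -
    rfl

end CechComplex

/-! ### Homogeneous parts of the Cech complex -/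

section Grading

variable {R : Type*} [CommRing R] {ι : Type*} {f : ι → R}
variable {M : Type*} [AddCommGroup M] [Module R M]
variable {γ : Type*} [AddCommGroup γ] {e : ι → γ} {ℳ : γ → AddSubgroup M}

variable (f e ℳ) in
/-- Projections of `M` to the homogeneous parts `ℳ g` that are compatible with multiplication by
the `f j`, where `f j` is homogeneous of degree `e j`. -/
structure HomogeneousProj where
  /-- The projection to `ℳ g`. -/
  proj : γ → M →+ M
  proj_mem : ∀ g x, proj g x ∈ ℳ g
  proj_of_mem : ∀ g, ∀ x ∈ ℳ g, proj g x = x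
  proj_smul : ∀ g j x, proj (g + e j) (f j • x) = f j • proj g x

namespace HomogeneousProj

theorem smul_mem (P : HomogeneousProj f e ℳ) (j : ι) (g : γ) (x : M) (hx : x ∈ ℳ g) :
    f j • x ∈ ℳ (g + e j) := by
  rw [← P.proj_of_mem g x hx, ← P.proj_smul]
  exact P.proj_mem _ _

theorem proj_famProd_smul (P : HomogeneousProj f e ℳ) (S : Finset ι) (g : γ) (x : M) :
    P.proj (g + ∑ j ∈ S, e j) (famProd f S • x) = famProd f S • P.proj g x := by
  classical
  induction S using Finset.induction_on with
  | empty => simp [famProd]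
  | insert a S ha ih =>
    rw [famProd, Finset.prod_insert ha, Finset.sum_insert ha, mul_smul, add_comm (e a), ← add_assoc,
      P.proj_smul, mul_smul]
    exact congrArg _ ih

theorem proj_famProd_pow_smul (P : HomogeneousProj f e ℳ) (S : Finset ι) (N : ℕ) (g : γ) (x : M) :
    P.proj (g + N • ∑ j ∈ S, e j) (famProd f S ^ N • x) = famProd f S ^ N • P.proj g x := by
  induction N with
  | zero => simp
  | succ N ih =>
    rw [pow_succ', mul_smul, mul_smul, succ_nsmul, ← add_assoc, P.proj_famProd_smul, ih]

end HomogeneousProj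

theorem famProd_smul_mem (hf : ∀ j g, ∀ x ∈ ℳ g, f j • x ∈ ℳ (g + e j)) (S : Finset ι) {g : γ}
    {x : M} (hx : x ∈ ℳ g) : famProd f S • x ∈ ℳ (g + ∑ j ∈ S, e j) := by
  classical
  induction S using Finset.induction_on with
  | empty => simpa [famProd] using hx
  | insert a S ha ih =>
    rw [famProd, Finset.prod_insert ha, Finset.sum_insert ha, mul_smul, add_comm (e a), ← add_assoc]
    exact hf _ _ _ ih

theorem famProd_pow_smul_mem (hf : ∀ j g, ∀ x ∈ ℳ g, f j • x ∈ ℳ (g + e j)) (S : Finset ι) (N : ℕ)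
    {g : γ} {x : M} (hx : x ∈ ℳ g) : famProd f S ^ N • x ∈ ℳ (g + N • ∑ j ∈ S, e j) := by
  induction N with
  | zero => simpa using hx
  | succ N ih =>
    rw [pow_succ', mul_smul, succ_nsmul, ← add_assoc]
    exact famProd_smul_mem hf S ih

theorem cechFrac_mem_locPart {S : Finset ι} {N : ℕ} {g : γ} {x : M}
    (hx : x ∈ ℳ (g + N • ∑ j ∈ S, e j)) : cechFrac f S N x ∈ locPart f e ℳ S g :=
  AddSubgroup.subset_closure ⟨N, x, hx, rfl⟩

/-- A homomorphism out of `M_{f_S}` maps the part of degree `g` to a subgroup if it does so for the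
homogeneous fractions. -/
theorem locPart_le_comap {S : Finset ι} {g : γ} {A : Type*} [AddCommGroup A]
    (φ : CechLoc f M S →+ A) (B : AddSubgroup A)
    (h : ∀ N, ∀ x ∈ ℳ (g + N • ∑ j ∈ S, e j), φ (cechFrac f S N x) ∈ B)
    {z : CechLoc f M S} (hz : z ∈ locPart f e ℳ S g) : φ z ∈ B := by
  have : locPart f e ℳ S g ≤ B.comap φ := (AddSubgroup.closure_le _).2 (by
    rintro _ ⟨N, x, hx, rfl⟩
    exact h N x hx)
  exact this hz

theorem smul_mem_locPart (hf : ∀ j g, ∀ x ∈ ℳ g, f j • x ∈ ℳ (g + e j)) (S : Finset ι) (j : ι)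
    {g : γ} {z : CechLoc f M S} (hz : z ∈ locPart f e ℳ S g) :
    f j • z ∈ locPart f e ℳ S (g + e j) :=
  locPart_le_comap (DistribSMul.toAddMonoidHom _ (f j)) _ (fun N x hx => by
    change f j • cechFrac f S N x ∈ _
    rw [smul_cechFrac]
    apply cechFrac_mem_locPart
    rw [add_right_comm]
    exact hf _ _ _ hx) hz

variable [LinearOrder ι]

theorem cechRes_mem_locPart (hf : ∀ j g, ∀ x ∈ ℳ g, f j • x ∈ ℳ (g + e j)) {T S : Finset ι}
    (h : T ⊆ S) {g : γ} {z : CechLoc f M T} (hz : z ∈ locPart f e ℳ T g) :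
    cechRes f M h z ∈ locPart f e ℳ S g :=
  locPart_le_comap (cechRes f M h).toAddMonoidHom _ (fun N x hx => by
    change cechRes f M h (cechFrac f T N x) ∈ _
    rw [cechRes_cechFrac]
    apply cechFrac_mem_locPart
    rw [← Finset.sum_sdiff h, nsmul_add, add_comm (N • _), ← add_assoc]
    exact famProd_pow_smul_mem hf _ _ hx) hz

theorem cechD_mem_cochainPart (hf : ∀ j g, ∀ x ∈ ℳ g, f j • x ∈ ℳ (g + e j)) {i : ℕ} {g : γ}
    {c : CechCochain f M i} (hc : c ∈ cochainPart f e ℳ i g) :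
    cechD f M i c ∈ cochainPart f e ℳ (i + 1) g := by
  intro S _
  rw [cechD_apply]
  refine AddSubgroup.sum_mem _ fun j _ => ?_
  have h := cechRes_mem_locPart hf (Finset.erase_subset j.1 S.1) (hc ⟨S.1.erase j.1, by
          rw [Finset.card_erase_of_mem j.2, S.2, Nat.add_sub_cancel]⟩ trivial)
  rcases neg_one_pow_eq_or R (S.1.filter (· < j.1)).card with h1 | h1
  · rw [h1, one_smul]
    exact h
  · rw [h1, neg_one_smul]
    exact AddSubgroup.neg_mem _ h

end Grading

/-! ### Homogeneous primitives of coboundaries -/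

section Primitive

variable {R : Type*} [CommRing R] {ι : Type*} {f : ι → R}
variable {M : Type*} [AddCommGroup M] [Module R M]
variable {γ : Type*} [AddCommGroup γ] {e : ι → γ} {ℳ : γ → AddSubgroup M}

namespace HomogeneousProj

variable (P : HomogeneousProj f e ℳ)

theorem cechFrac_proj_congr (S : Finset ι) (g : γ) {N N' : ℕ} {x y : M}
    (h : cechFrac f S N x = cechFrac f S N' y) :
    cechFrac f S N (P.proj (g + N • ∑ j ∈ S, e j) x) =
      cechFrac f S N' (P.proj (g + N' • ∑ j ∈ S, e j) y) := by
  rw [cechFrac_eq_iff] at h ⊢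
  obtain ⟨c, h⟩ := h
  refine ⟨c, ?_⟩
  rw [← P.proj_famProd_pow_smul, ← P.proj_famProd_pow_smul, h]
  congr 2
  rw [add_nsmul, add_nsmul]
  abel

/-- The sum is given by an arbitrary fraction because `locProj` chooses representatives of `z`, `w`
and `z + w` independently. -/
theorem cechFrac_proj_add (S : Finset ι) (g : γ) {N N' L : ℕ} {x y z : M}
    (h : cechFrac f S L z = cechFrac f S N x + cechFrac f S N' y) :
    cechFrac f S L (P.proj (g + L • ∑ j ∈ S, e j) z) =
      cechFrac f S N (P.proj (g + N • ∑ j ∈ S, e j) x) +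
        cechFrac f S N' (P.proj (g + N' • ∑ j ∈ S, e j) y) := by
  have hadd : ∀ x y : M, cechFrac f S N x + cechFrac f S N' y =
      cechFrac f S (N + N') (famProd f S ^ N' • x + famProd f S ^ N • y) := fun x y => by
    rw [cechFrac, cechFrac, LocalizedModule.mk_add_mk, cechFrac]
    exact congrArg _ (Subtype.ext (pow_add _ _ _).symm)
  rw [hadd] at h ⊢
  rw [P.cechFrac_proj_congr S g h, map_add, ← P.proj_famProd_pow_smul, ← P.proj_famProd_pow_smul]
  congr 4 <;> rw [add_nsmul] <;> abel

/-- The projection of `M_{f_S}` to its part of degree `g`. -/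
def locProj (S : Finset ι) (g : γ) : CechLoc f M S →+ CechLoc f M S :=
  AddMonoidHom.mk' (fun z => cechFrac f S (exists_cechFrac f z).choose
    (P.proj (g + (exists_cechFrac f z).choose • ∑ j ∈ S, e j)
      (exists_cechFrac f z).choose_spec.choose)) fun z w => by
    apply P.cechFrac_proj_add
    rw [← (exists_cechFrac f z).choose_spec.choose_spec,
      ← (exists_cechFrac f w).choose_spec.choose_spec,
      ← (exists_cechFrac f (z + w)).choose_spec.choose_spec]

theorem locProj_cechFrac (S : Finset ι) (g : γ) (N : ℕ) (x : M) :
    P.locProj S g (cechFrac f S N x) = cechFrac f S N (P.proj (g + N • ∑ j ∈ S, e j) x) :=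
  P.cechFrac_proj_congr S g (exists_cechFrac f (cechFrac f S N x)).choose_spec.choose_spec.symm

theorem locProj_mem (S : Finset ι) (g : γ) (z : CechLoc f M S) :
    P.locProj S g z ∈ locPart f e ℳ S g := by
  obtain ⟨N, x, rfl⟩ := exists_cechFrac f z
  rw [locProj_cechFrac]
  exact cechFrac_mem_locPart (P.proj_mem _ _)

theorem locProj_of_mem (S : Finset ι) (g : γ) {z : CechLoc f M S} (hz : z ∈ locPart f e ℳ S g) :
    P.locProj S g z = z := by
  have h := locPart_le_comap (P.locProj S g - AddMonoidHom.id _) ⊥ (fun N x hx => by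
    rw [AddSubgroup.mem_bot, AddMonoidHom.sub_apply, P.locProj_cechFrac, P.proj_of_mem _ _ hx]
    exact sub_self _) hz
  exact sub_eq_zero.1 (AddSubgroup.mem_bot.1 h)

variable [LinearOrder ι]

theorem locProj_cechRes {T S : Finset ι} (h : T ⊆ S) (g : γ) (z : CechLoc f M T) :
    P.locProj S g (cechRes f M h z) = cechRes f M h (P.locProj T g z) := by
  obtain ⟨N, x, rfl⟩ := exists_cechFrac f z
  rw [P.locProj_cechFrac, cechRes_cechFrac, cechRes_cechFrac, P.locProj_cechFrac,
    ← P.proj_famProd_pow_smul, ← Finset.sum_sdiff h, nsmul_add]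
  congr 2
  abel_nf

/-- Projection to degree `g` commutes with the restriction maps, hence with the differential, and
fixes the homogeneous cochain `d b`. The projection of `b` is thus a primitive as well. -/
theorem exists_homogeneous_primitive (P : HomogeneousProj f e ℳ) {i : ℕ} {g : γ}
    {b : CechCochain f M i}
    (hb : cechD f M i b ∈ cochainPart f e ℳ (i + 1) g) :
    ∃ b' ∈ cochainPart f e ℳ i g, cechD f M i b' = cechD f M i b := by
  refine ⟨fun S => P.locProj S.1 g (b S), fun S _ => P.locProj_mem _ _ _, ?_⟩
  ext S
  rw [← P.locProj_of_mem S.1 g (hb S trivial), cechD_apply, cechD_apply, map_sum]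
  refine Finset.sum_congr rfl fun j _ => ?_
  rw [← P.locProj_cechRes]
  rcases neg_one_pow_eq_or R (S.1.filter (· < j.1)).card with h1 | h1
  · rw [h1, one_smul, one_smul]
  · rw [h1, neg_one_smul, neg_one_smul, map_neg]

theorem exists_primitive_of_localCohomologyPart_eq_bot (P : HomogeneousProj f e ℳ) {i : ℕ} {g : γ}
    (h : localCohomologyPart f e ℳ (i + 1) g = ⊥) {c : CechCochain f M (i + 1)}
    (hc : c ∈ cochainPart f e ℳ (i + 1) g) (hd : cechD f M (i + 1) c = 0) :
    ∃ b ∈ cochainPart f e ℳ i g, cechD f M i b = c := by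
  have h1 : Submodule.mkQ ((cechCoboundaries f M (i + 1)).submoduleOf (cechCocycles f M (i + 1)))
      ⟨c, hd⟩ ∈ localCohomologyPart f e ℳ (i + 1) g := ⟨⟨c, hd⟩, hc, rfl⟩
  rw [h, AddSubgroup.mem_bot, Submodule.mkQ_apply, Submodule.Quotient.mk_eq_zero] at h1
  obtain ⟨b, rfl⟩ : ∃ b, cechD f M i b = c := h1
  exact P.exists_homogeneous_primitive hc

end HomogeneousProj

theorem eq_zero_of_localCohomologyPart_zero_eq_bot [LinearOrder ι] {g : γ}
    (h : localCohomologyPart f e ℳ 0 g = ⊥) {c : CechCochain f M 0}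
    (hc : c ∈ cochainPart f e ℳ 0 g) (hd : cechD f M 0 c = 0) : c = 0 := by
  have h1 : Submodule.mkQ ((cechCoboundaries f M 0).submoduleOf (cechCocycles f M 0))
      ⟨c, hd⟩ ∈ localCohomologyPart f e ℳ 0 g := ⟨⟨c, hd⟩, hc, rfl⟩
  rw [h, AddSubgroup.mem_bot, Submodule.mkQ_apply, Submodule.Quotient.mk_eq_zero] at h1
  exact h1

/-! ### Inverting a member of the family -/

/-- The inverse of multiplication by `f j` on `M_{f_S}`, for `j ∈ S`. -/
def locInv [DecidableEq ι] (f : ι → R) (M : Type*) [AddCommGroup M] [Module R M] (S : Finset ι)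
    (j : ι) : CechLoc f M S →ₗ[R] CechLoc f M S :=
  famProd f (S.erase j) • LocalizedModule.divBy (Submonoid.pow (famProd f S) 1)

theorem locInv_cechFrac [DecidableEq ι] (S : Finset ι) (j : ι) (N : ℕ) (x : M) :
    locInv f M S j (cechFrac f S N x) = cechFrac f S (N + 1) (famProd f (S.erase j) • x) := by
  rw [locInv, LinearMap.smul_apply, LocalizedModule.divBy_apply, LocalizedModule.liftOn_mk,
    LocalizedModule.smul'_mk, cechFrac]
  exact congrArg _ (Subtype.ext (pow_add _ _ _).symm)

theorem smul_locInv [DecidableEq ι] {S : Finset ι} {j : ι} (hj : j ∈ S) (z : CechLoc f M S) :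
    f j • locInv f M S j z = z := by
  obtain ⟨N, x, rfl⟩ := exists_cechFrac f z
  rw [locInv_cechFrac, smul_cechFrac, smul_smul, famProd, Finset.mul_prod_erase S f hj,
    cechFrac_eq_iff]
  refine ⟨0, ?_⟩
  rw [smul_smul, zero_add, zero_add, pow_succ]
  rfl

theorem locInv_mem_locPart [DecidableEq ι] (hf : ∀ j g, ∀ x ∈ ℳ g, f j • x ∈ ℳ (g + e j))
    {S : Finset ι} {j : ι} (hj : j ∈ S) {g : γ} {z : CechLoc f M S}
    (hz : z ∈ locPart f e ℳ S (g + e j)) : locInv f M S j z ∈ locPart f e ℳ S g :=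
  locPart_le_comap (locInv f M S j).toAddMonoidHom _ (fun N x hx => by
    change locInv f M S j (cechFrac f S N x) ∈ _
    rw [locInv_cechFrac]
    apply cechFrac_mem_locPart
    have h := famProd_smul_mem hf (S.erase j) hx
    convert h using 2
    rw [succ_nsmul, ← Finset.add_sum_erase S e hj]
    abel) hz

end Primitive

/-! ### Vanishing of local cohomology and generators -/

section Generators

variable {R : Type*} [CommRing R] {ι : Type*} {f : ι → R}
variable {M : Type*} [AddCommGroup M] [Module R M]
variable {γ : Type*} [AddCommGroup γ] {ε : γ} {ℳ : γ → AddSubgroup M}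

theorem sub_succ_nsmul_add (g ε : γ) (i : ℕ) : g - (i + 1) • ε + ε = g - i • ε := by
  rw [succ_nsmul]
  abel

theorem smul_mem_cochainPart (hf : ∀ j g, ∀ x ∈ ℳ g, f j • x ∈ ℳ (g + ε)) {i : ℕ} (j : ι) {g : γ}
    {c : CechCochain f M i} (hc : c ∈ cochainPart f (fun _ => ε) ℳ i g) :
    f j • c ∈ cochainPart f (fun _ => ε) ℳ i (g + ε) :=
  fun S _ => smul_mem_locPart (e := fun _ => ε) hf S.1 j (hc S trivial)

theorem cechFrac_empty_injective : Function.Injective (cechFrac (M := M) f ∅ 0) := by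
  intro x y h
  obtain ⟨c, h⟩ := (cechFrac_eq_iff f).1 h
  simpa [famProd] using h

theorem exists_of_mem_locPart_empty {g : γ} {z : CechLoc f M ∅}
    (hz : z ∈ locPart f (fun _ => ε) ℳ ∅ g) : ∃ x ∈ ℳ g, cechFrac f ∅ 0 x = z := by
  have h := locPart_le_comap (AddMonoidHom.id _) ((ℳ g).map (LocalizedModule.mkLinearMap
    (Submonoid.powers (famProd f ∅)) M).toAddMonoidHom)
    (fun N x hx => ⟨x, by simpa using hx, ?_⟩) hz
  · obtain ⟨x, hx, h⟩ := h
    exact ⟨x, hx, (cechFrac_zero f ∅ x).trans h⟩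
  refine (cechFrac_zero f ∅ x).symm.trans ?_
  change cechFrac f ∅ 0 x = cechFrac f ∅ N x
  rw [cechFrac_eq_iff]
  exact ⟨0, by simp [famProd]⟩

variable [LinearOrder ι] [Fintype ι]

/-- Exactness of the Koszul direction in positive Čech degree, with control of degrees: the
contraction divides by some `f j`, lowering the degree by ε. -/
theorem exists_koszulD_eq (hf : ∀ j g, ∀ x ∈ ℳ g, f j • x ∈ ℳ (g + ε)) {i l : ℕ} {g : γ}
    (z : List ι → CechCochain f M (i + 1))
    (hz : ∀ t, t.length = l → z t ∈ cochainPart f (fun _ => ε) ℳ (i + 1) (g + ε))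
    (hd : ∀ t, t.length + 1 = l → koszulD f t z = 0) :
    ∃ w : List ι → CechCochain f M (i + 1), (∀ t, t.length = l → koszulD f t w = z t) ∧
      ∀ t, t.length = l + 1 → w t ∈ cochainPart f (fun _ => ε) ℳ (i + 1) g := by
  have hne : ∀ S : {S : Finset ι // S.card = i + 1}, ∃ j, j ∈ S.1 := fun S =>
    Finset.card_pos.1 (by rw [S.2]; exact Nat.succ_pos i)
  choose j hj using hne
  -- The contraction is built separately on each factor `M_{f_S}`, with its own `j S ∈ S`.
  refine ⟨fun t S => koszulH (j S) (locInv f M S.1 (j S)) (fun s => z s S) t, fun t ht => ?_,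
    fun t ht S _ => ?_⟩
  · ext S
    rw [← LinearMap.proj_apply (R := R) (φ := fun S : {S : Finset ι // S.card = i + 1} =>
      CechLoc f M S.1) S (koszulD f t _), ← koszulD_map]
    refine (koszulD_koszulH f (smul_locInv (hj S)) t (fun s => z s S)).trans ?_
    have h0 : koszulH (j S) (locInv f M S.1 (j S))
        (fun s => koszulD f s (fun r => z r S)) t = 0 := by
      -- At the empty word `hd` is vacuous, but there the homotopy is 0 by definition.
      cases t with
      | nil => rfl
      | cons k t =>
        have h1 : koszulD f t (fun r => z r S) = 0 := by
          have h2 := koszulD_map f (LinearMap.proj (R := R)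
            (φ := fun S : {S : Finset ι // S.card = i + 1} => CechLoc f M S.1) S) t z
          rw [hd t (by simpa using ht), map_zero] at h2
          exact h2
        simp [koszulH, h1]
    rw [h0, sub_zero]
  · cases t with
    | nil => simp at ht
    | cons k t =>
      simp only [koszulH]
      split_ifs
      · exact locInv_mem_locPart (e := fun _ => ε) hf (hj S) (hz t (by simpa using ht) S trivial)
      · exact AddSubgroup.zero_mem _

/-- The zigzag, by descending induction on the Čech degree `i`: words of length `i` are paired with
Čech degree `i` and internal degree `g - i ε`. -/
theorem exists_koszulD_sub_cocycle (P : HomogeneousProj f (fun _ => ε) ℳ) {g : γ}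
    (hv : ∀ i : ℕ, localCohomologyPart f (fun _ => ε) ℳ (i + 1) (g - (i + 1) • ε) = ⊥) (n : ℕ) :
    ∀ i : ℕ, Fintype.card ι ≤ i + n → ∀ a : List ι → CechCochain f M i,
      (∀ t, t.length = i → a t ∈ cochainPart f (fun _ => ε) ℳ i (g - i • ε)) →
      (∀ t, t.length + 1 = i → koszulD f t (fun s => cechD f M i (a s)) = 0) →
      ∃ b : List ι → CechCochain f M i,
        (∀ t, t.length = i + 1 → b t ∈ cochainPart f (fun _ => ε) ℳ i (g - (i + 1) • ε)) ∧
        ∀ t, t.length = i → cechD f M i (koszulD f t b) = cechD f M i (a t) := by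
  have hf := P.smul_mem
  induction n with
  | zero =>
    intro i hi a _ _
    -- For `i ≥ #ι` there is no `S` of size `i + 1`, so the target of the differential is zero.
    refine ⟨0, fun t _ => AddSubgroup.zero_mem _, fun t _ => ?_⟩
    ext S
    have := S.2 ▸ Finset.card_le_univ S.1
    omega
  | succ n ih =>
    intro i hi a ha had
    obtain ⟨a', ha', ha'g⟩ := exists_koszulD_eq (g := g - (i + 1) • ε) hf
      (fun s => cechD f M i (a s)) (l := i) (fun t ht => by
        have h := cechD_mem_cochainPart (e := fun _ => ε) hf (ha t ht)
        rwa [sub_succ_nsmul_add]) had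
    obtain ⟨b', hb', hdb'⟩ := ih (i + 1) (by omega) a' ha'g (fun t ht => by
      rw [koszulD_map, ha' t (by omega), cechD_cechD])
    -- Writing `D` for the Koszul boundary: `d a = D a'` and `d D b' = d a'`, so `a' - D b'` is a
    -- cocycle and has a primitive `b`. Then `d D b = D (a' - D b') = D a' = d a`.
    have hprim : ∀ t : List ι, t.length = i + 1 → ∃ b ∈ cochainPart f (fun _ => ε) ℳ i
        (g - (i + 1) • ε), cechD f M i b = a' t - koszulD f t b' := fun t ht => by
      refine P.exists_primitive_of_localCohomologyPart_eq_bot (hv i)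
        (AddSubgroup.sub_mem _ (ha'g t ht) ?_) (by rw [map_sub, hdb' t ht, sub_self])
      refine koszulD_mem f (fun j x hx => ?_) t b' (fun s hs => hb' s (by omega))
      have h := smul_mem_cochainPart hf j hx
      rwa [sub_succ_nsmul_add] at h
    choose b hb hdb using hprim
    classical
    -- The value on words of other lengths is irrelevant, since the boundary at `t` only reads words
    -- of length `t.length + 1`.
    refine ⟨fun t => if ht : t.length = i + 1 then b t ht else 0, fun t ht => ?_, fun t ht => ?_⟩
    · beta_reduce
      rw [dif_pos ht]
      exact hb t ht
    · rw [← koszulD_map, koszulD_congr f t (b := a' - fun s => koszulD f s b'), map_sub,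
        koszulD_koszulD, sub_zero, ha' t ht]
      intro s hs
      rw [dif_pos (by omega), hdb]
      rfl

/-- If `H^i_I(M)` vanishes in degree `g - i ε` for all `i`, where `I` is generated by elements `f j`
of degree `ε`, then every element of `M` of degree `g` is a combination of the `f j` with
coefficients in `M` of degree `g - ε`. -/
theorem exists_eq_sum_smul_of_localCohomologyPart_eq_bot
    (P : HomogeneousProj f (fun _ => ε) ℳ) {g : γ}
    (hv : ∀ i : ℕ, localCohomologyPart f (fun _ => ε) ℳ i (g - i • ε) = ⊥) {x : M}
    (hx : x ∈ ℳ g) : ∃ y : ι → M, (∀ j, y j ∈ ℳ (g - ε)) ∧ x = ∑ j, f j • y j := by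
  have hf := P.smul_mem
  have hS : ∀ S : {S : Finset ι // S.card = 0}, S = ⟨∅, rfl⟩ := fun S =>
    Subtype.ext (Finset.card_eq_zero.1 S.2)
  have ha : (fun S => cechFrac f S.1 0 x : CechCochain f M 0) ∈
      cochainPart f (fun _ => ε) ℳ 0 g := fun S _ => cechFrac_mem_locPart (by simpa using hx)
  -- The zigzag starts from `x` in Čech degree 0 at the empty word, where the Koszul cycle condition
  -- is vacuous.
  obtain ⟨b, hb, hdb⟩ := exists_koszulD_sub_cocycle P (fun i => hv (i + 1)) (Fintype.card ι) 0
    (by omega) (fun _ S => cechFrac f S.1 0 x) (fun t _ => by simpa using ha)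
    (fun t ht => by omega)
  simp only [zero_add, one_nsmul] at hb
  have hb' : ∀ j : ι, ∃ y ∈ ℳ (g - ε), cechFrac f ∅ 0 y = b [j] ⟨∅, rfl⟩ := fun j =>
    exists_of_mem_locPart_empty (hb [j] rfl ⟨∅, rfl⟩ trivial)
  choose y hy hyb using hb'
  refine ⟨y, hy, ?_⟩
  -- The boundary of `b` at the empty word minus `x` is a 0-cocycle of degree `g`, hence zero
  -- because `H^0` vanishes there.
  have h0 := eq_zero_of_localCohomologyPart_zero_eq_bot (by simpa using hv 0)
    (AddSubgroup.sub_mem _ (koszulD_mem f (A := cochainPart f (fun _ => ε) ℳ 0 (g - ε))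
      (fun j c hc => by simpa using smul_mem_cochainPart hf j hc) [] b (fun s hs => hb s hs)) ha)
    (by rw [map_sub, hdb [] rfl, sub_self])
  have h1 := congrFun (sub_eq_zero.1 h0) ⟨∅, rfl⟩
  rw [koszulD_nil, Finset.sum_apply] at h1
  apply cechFrac_empty_injective (f := f)
  rw [← h1]
  rw [cechFrac_zero, map_sum]
  refine Finset.sum_congr rfl fun j _ => ?_
  rw [map_smul, ← cechFrac_zero, hyb]
  rfl

end Generators

/-! ### Projections of a graded module -/

section FilterProj

variable {γ : Type*} [DecidableEq γ] {M : Type*} [AddCommGroup M]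
variable (ℳ : γ → AddSubgroup M) [DirectSum.Decomposition ℳ]

/-- The projection of `M` to the sum of the homogeneous parts with degree in `{g | Q g}`. -/
def filterProj (Q : γ → Prop) [DecidablePred Q] : M →+ M :=
  (DirectSum.decomposeAddEquiv ℳ).symm.toAddMonoidHom.comp
    ((DFinsupp.filterAddMonoidHom (fun g => ℳ g) Q).comp
      (DirectSum.decomposeAddEquiv ℳ).toAddMonoidHom)

theorem filterProj_of_mem (Q : γ → Prop) [DecidablePred Q] {g : γ} {x : M} (hx : x ∈ ℳ g) :
    filterProj ℳ Q x = if Q g then x else 0 := by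
  change (DirectSum.decompose ℳ).symm (DFinsupp.filter Q (DirectSum.decompose ℳ x)) = _
  rw [DirectSum.decompose_of_mem ℳ hx]
  change (DirectSum.decompose ℳ).symm (DFinsupp.filter Q (DFinsupp.single g _)) = _
  rw [DFinsupp.filter_single]
  split_ifs
  · exact DirectSum.decompose_symm_of ℳ _
  · exact DirectSum.decompose_symm_zero ℳ

theorem filterProj_mem (Q : γ → Prop) [DecidablePred Q] (x : M) :
    filterProj ℳ Q x ∈ ⨆ g : {g // Q g}, ℳ g.1 := by
  induction x using DirectSum.Decomposition.inductionOn ℳ with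
  | zero => rw [map_zero]; exact AddSubgroup.zero_mem _
  | @homogeneous g x =>
    rw [filterProj_of_mem ℳ Q x.2]
    split_ifs with h
    · exact AddSubgroup.mem_iSup_of_mem (S := fun g : {g // Q g} => ℳ g.1) ⟨g, h⟩ x.2
    · exact AddSubgroup.zero_mem _
  | add x y hx hy => rw [map_add]; exact AddSubgroup.add_mem _ hx hy

theorem filterProj_of_mem_iSup (Q : γ → Prop) [DecidablePred Q] {x : M}
    (hx : x ∈ ⨆ g : {g // Q g}, ℳ g.1) : filterProj ℳ Q x = x := by
  have h : ⨆ g : {g // Q g}, ℳ g.1 ≤ (filterProj ℳ Q - AddMonoidHom.id M).ker :=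
    iSup_le fun g y hy => by
      rw [AddMonoidHom.mem_ker, AddMonoidHom.sub_apply, filterProj_of_mem ℳ Q hy, if_pos g.2]
      exact sub_self _
  exact sub_eq_zero.1 (AddMonoidHom.mem_ker.1 (h hx))

/-- Stated for predicates so as to serve both single bidegrees and total degrees. -/
theorem filterProj_smul [Add γ] {R : Type*} [Ring R] [Module R M] {r : R} {e : γ}
    (hr : ∀ g, ∀ x ∈ ℳ g, r • x ∈ ℳ (g + e)) (Q Q' : γ → Prop) [DecidablePred Q]
    [DecidablePred Q'] (hQ : ∀ g, Q' (g + e) ↔ Q g) (x : M) :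
    filterProj ℳ Q' (r • x) = r • filterProj ℳ Q x := by
  induction x using DirectSum.Decomposition.inductionOn ℳ with
  | zero => simp
  | @homogeneous g x =>
    rw [filterProj_of_mem ℳ Q x.2, filterProj_of_mem ℳ Q' (hr _ _ x.2)]
    by_cases h : Q g
    · rw [if_pos h, if_pos ((hQ g).2 h)]
    · rw [if_neg h, if_neg (mt (hQ g).1 h), smul_zero]
  | add x y hx hy => simp [hx, hy]

end FilterProj

section HomogeneousProj

variable {R : Type*} [CommRing R] {ι : Type*} {f : ι → R} {M : Type*} [AddCommGroup M] [Module R M]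

/-- The projections to the homogeneous parts of a graded module. -/
def HomogeneousProj.ofDecomposition {γ : Type*} [DecidableEq γ] [AddCommGroup γ] {e : ι → γ}
    (ℳ : γ → AddSubgroup M) [DirectSum.Decomposition ℳ]
    (hf : ∀ j g, ∀ x ∈ ℳ g, f j • x ∈ ℳ (g + e j)) : HomogeneousProj f e ℳ where
  proj g := filterProj ℳ (· = g)
  proj_mem g x := (iSup_le (by rintro ⟨_, rfl⟩; exact le_rfl) :
    ⨆ g' : {g' // g' = g}, ℳ g'.1 ≤ ℳ g) (filterProj_mem ℳ (· = g) x)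
  proj_of_mem g x hx := by rw [filterProj_of_mem ℳ _ hx, if_pos rfl]
  proj_smul g j x := filterProj_smul ℳ (hf j) (fun g' => g' = g) (fun g' => g' = g + e j)
    (fun g' => add_left_inj (e j)) x

/-- The projections to the homogeneous parts for the total grading of a bigraded module. -/
def HomogeneousProj.sharp {e : ι → ℤ × ℤ} (ℳ : ℤ × ℤ → AddSubgroup M) [DirectSum.Decomposition ℳ]
    (hf : ∀ j g, ∀ x ∈ ℳ g, f j • x ∈ ℳ (g + e j)) :
    HomogeneousProj f (fun j => (e j).1 + (e j).2) (BigradedRegularity.sharp ℳ) where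
  proj t := filterProj ℳ (fun g => g.1 + g.2 = t)
  proj_mem t x := filterProj_mem ℳ _ x
  proj_of_mem t x hx := filterProj_of_mem_iSup ℳ _ hx
  proj_smul t j x := filterProj_smul ℳ (hf j) (fun g => g.1 + g.2 = t)
    (fun g => g.1 + g.2 = t + ((e j).1 + (e j).2)) (fun g => by
    rw [Prod.fst_add, Prod.snd_add]; omega) x

end HomogeneousProj

/-! ### Bigraded modules over the polynomial ring -/

section Bigraded

variable {K : Type*} [Field K] {m n : ℕ} {M : Type*} [AddCommGroup M] [Module (BiPoly K m n) M]
variable (ℳ : ℤ × ℤ → AddSubgroup M)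

theorem X_smul_mem [SetLike.GradedSMul (polyPart K m n) ℳ] (v : Fin (m + 1) ⊕ Fin (n + 1))
    (g : ℤ × ℤ) (x : M) (hx : x ∈ ℳ g) :
    (MvPolynomial.X v : BiPoly K m n) • x ∈ ℳ (g + varDeg m n v) := by
  have h := SetLike.GradedSMul.smul_mem (A := polyPart K m n) (B := ℳ)
    (MvPolynomial.isWeightedHomogeneous_X K (varDeg m n) v) hx
  rwa [vadd_eq_add, add_comm] at h

theorem C_smul_mem [SetLike.GradedSMul (polyPart K m n) ℳ] (c : K) (g : ℤ × ℤ) (x : M)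
    (hx : x ∈ ℳ g) : (MvPolynomial.C c : BiPoly K m n) • x ∈ ℳ (g + 0) := by
  have h := SetLike.GradedSMul.smul_mem (A := polyPart K m n) (B := ℳ)
    (MvPolynomial.isWeightedHomogeneous_C (varDeg m n) c) hx
  rwa [vadd_eq_add, add_comm] at h

/-- The sum of the homogeneous parts of total degree at least `t`. -/
def totalGE (t : ℤ) : AddSubgroup M := ⨆ g : {g : ℤ × ℤ // t ≤ g.1 + g.2}, ℳ g.1

theorem le_totalGE {t : ℤ} {g : ℤ × ℤ} (h : t ≤ g.1 + g.2) : ℳ g ≤ totalGE ℳ t :=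
  le_iSup (fun g : {g : ℤ × ℤ // t ≤ g.1 + g.2} => ℳ g.1) ⟨g, h⟩

theorem totalGE_antitone : Antitone (totalGE ℳ) :=
  fun _ _ h => iSup_le fun g => le_totalGE ℳ (h.trans g.2)

theorem smul_mem_totalGE_of_shift {r : BiPoly K m n} {e : ℤ × ℤ}
    (hr : ∀ g, ∀ x ∈ ℳ g, r • x ∈ ℳ (g + e)) (he : 0 ≤ e.1 + e.2) {t : ℤ} {x : M}
    (hx : x ∈ totalGE ℳ t) : r • x ∈ totalGE ℳ t := by
  have h : totalGE ℳ t ≤ (totalGE ℳ t).comap (DistribSMul.toAddMonoidHom M r) :=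
    iSup_le fun g y hy => le_totalGE ℳ (by
      have := g.2
      rw [Prod.fst_add, Prod.snd_add]
      omega) (hr _ _ hy)
  exact h hx

theorem smul_mem_totalGE [SetLike.GradedSMul (polyPart K m n) ℳ] (r : BiPoly K m n) {t : ℤ} {x : M}
    (hx : x ∈ totalGE ℳ t) : r • x ∈ totalGE ℳ t := by
  induction r using MvPolynomial.induction_on with
  | C c => exact smul_mem_totalGE_of_shift ℳ (C_smul_mem ℳ c) le_rfl hx
  | add p q hp hq => rw [add_smul]; exact AddSubgroup.add_mem _ hp hq
  | mul_X p v hp =>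
    rw [mul_comm, mul_smul]
    exact smul_mem_totalGE_of_shift ℳ (X_smul_mem ℳ v) (by cases v <;> simp [varDeg]) hp

variable [DirectSum.Decomposition ℳ]

theorem exists_mem_totalGE (x : M) : ∃ t, x ∈ totalGE ℳ t := by
  induction x using DirectSum.Decomposition.inductionOn ℳ with
  | zero => exact ⟨0, AddSubgroup.zero_mem _⟩
  | @homogeneous g x => exact ⟨_, le_totalGE ℳ le_rfl x.2⟩
  | add x y hx hy =>
    obtain ⟨t, ht⟩ := hx
    obtain ⟨u, hu⟩ := hy
    exact ⟨min t u, AddSubgroup.add_mem _ (totalGE_antitone ℳ (min_le_left _ _) ht)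
      (totalGE_antitone ℳ (min_le_right _ _) hu)⟩

-- All variables have total degree 1, so the part of total degree at least `t₀` is a submodule; it
-- is everything once `t₀` bounds the degrees of finitely many generators.
variable (K m n) in
theorem exists_eq_bot_of_total_lt [SetLike.GradedSMul (polyPart K m n) ℳ]
    [Module.Finite (BiPoly K m n) M] : ∃ t₀ : ℤ, ∀ g : ℤ × ℤ, g.1 + g.2 < t₀ → ℳ g = ⊥ := by
  obtain ⟨s, hs⟩ := Module.Finite.fg_top (R := BiPoly K m n) (M := M)
  choose t ht using exists_mem_totalGE ℳ
  obtain ⟨t₀, ht₀⟩ := (s.image t).bddBelow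
  have hle : Submodule.span (BiPoly K m n) (s : Set M) ≤
      { totalGE ℳ t₀ with smul_mem' := fun r _ => smul_mem_totalGE ℳ r } :=
    Submodule.span_le.2 fun x hx => totalGE_antitone ℳ
      (ht₀ (Finset.mem_coe.2 (Finset.mem_image_of_mem t hx))) (ht x)
  refine ⟨t₀, fun g hg => (AddSubgroup.eq_bot_iff_forall _).2 fun x hx => ?_⟩
  have hx' : x ∈ totalGE ℳ t₀ := hle (hs ▸ Submodule.mem_top)
  -- Projection to total degrees at least `t₀` fixes `x` and also kills it.
  rw [← filterProj_of_mem_iSup ℳ (fun g => t₀ ≤ g.1 + g.2) hx', filterProj_of_mem ℳ _ hx,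
    if_neg (by omega)]

variable (K m n) in
/-- The projections to the bigraded parts, for multiplication by the `x_i`. -/
def xProj [SetLike.GradedSMul (polyPart K m n) ℳ] :
    HomogeneousProj (xVars K m n) (fun _ => ((1, 0) : ℤ × ℤ)) ℳ :=
  .ofDecomposition ℳ fun i => X_smul_mem ℳ (Sum.inl i)

variable (K m n) in
/-- The projections to the bigraded parts, for multiplication by the `y_j`. -/
def yProj [SetLike.GradedSMul (polyPart K m n) ℳ] :
    HomogeneousProj (yVars K m n) (fun _ => ((0, 1) : ℤ × ℤ)) ℳ :=
  .ofDecomposition ℳ fun j => X_smul_mem ℳ (Sum.inr j)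

theorem varDeg_total (v : Fin (m + 1) ⊕ Fin (n + 1)) : (varDeg m n v).1 + (varDeg m n v).2 = 1 := by
  cases v <;> rfl

variable (K m n) in
/-- The projections to the parts of given total degree, for multiplication by all variables. -/
def xyProj [SetLike.GradedSMul (polyPart K m n) ℳ] :
    HomogeneousProj (xyVars K m n) (fun _ => (1 : ℤ)) (sharp ℳ) :=
  (funext fun v => varDeg_total (ofLex v) :
    (fun v : Fin (m + 1) ⊕ₗ Fin (n + 1) => (varDeg m n (ofLex v)).1 + (varDeg m n (ofLex v)).2) =
      fun _ => 1) ▸ HomogeneousProj.sharp ℳ fun v => X_smul_mem ℳ (ofLex v)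

variable {ℳ} in
/-- Under `VC_d(p, p')`, an element of bidegree outside `DReg_d(p, p')` is a combination of
elements of smaller total degree. -/
theorem VC.mem_of_notMem_DReg [SetLike.GradedSMul (polyPart K m n) ℳ] {d : ℕ} {p p' : ℤ}
    (h : VC (K := K) (m := m) (n := n) ℳ d p p') {N : Submodule (BiPoly K m n) M} {k k' : ℤ}
    (hN : sharp ℳ (k + k' - 1) ≤ N.toAddSubgroup) (hk : (k, k') ∉ DReg d p p') {x : M}
    (hx : x ∈ ℳ (k, k')) : x ∈ N := by
  have hle : ∀ {t : ℤ} (g : ℤ × ℤ), g.1 + g.2 = t → ℳ g ≤ sharp ℳ t := fun g hg =>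
    le_iSup (fun h : {h : ℤ × ℤ // h.1 + h.2 = _} => ℳ h.1) ⟨g, hg⟩
  have hsum : ∀ {ι : Type} [Fintype ι] (f : ι → BiPoly K m n) (y : ι → M),
      (∀ j, y j ∈ sharp ℳ (k + k' - 1)) → ∑ j, f j • y j ∈ N := fun f y hy =>
    N.sum_mem fun j _ => N.smul_mem _ (hN (hy j))
  rw [mem_DReg_iff] at hk
  by_cases h1 : k ≤ p + d
  · by_cases h2 : k' ≤ p' + d
    · obtain ⟨y, hy, hxy⟩ := exists_eq_sum_smul_of_localCohomologyPart_eq_bot (xyProj K m n ℳ)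
        (g := k + k') (fun i => h.xy_vanish i _ (by rw [nsmul_one]; omega)) (x := x)
        (hle (k, k') rfl hx)
      rw [hxy]
      exact hsum (xyVars K m n) y hy
    · have hv : ∀ i : ℕ, localCohomologyPart (yVars K m n) (fun _ => ((0, 1) : ℤ × ℤ)) ℳ i
          ((k, k') - i • (0, 1)) = ⊥ := fun i => h.y_vanish i _ _ (by
            rw [Prod.smul_snd, nsmul_one]; dsimp only; omega)
      obtain ⟨y, hy, rfl⟩ := exists_eq_sum_smul_of_localCohomologyPart_eq_bot (yProj K m n ℳ) hv hx
      exact hsum _ y fun j => hle _ (by rw [Prod.fst_sub, Prod.snd_sub]; dsimp only; omega) (hy j)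
  · have hv : ∀ i : ℕ, localCohomologyPart (xVars K m n) (fun _ => ((1, 0) : ℤ × ℤ)) ℳ i
        ((k, k') - i • (1, 0)) = ⊥ := fun i => h.x_vanish i _ _ (by
          rw [Prod.smul_fst, nsmul_one]; dsimp only; omega)
    obtain ⟨y, hy, rfl⟩ := exists_eq_sum_smul_of_localCohomologyPart_eq_bot (xProj K m n ℳ) hv hx
    exact hsum _ y fun j => hle _ (by rw [Prod.fst_sub, Prod.snd_sub]; dsimp only; omega) (hy j)

end Bigraded

end BigradedRegularity

end

/-! ### Generation in `DReg_d(p, p')`, by induction on the total degree. -/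

open BigradedRegularity in
theorem propositionP {K : Type*} [Field K] (m n : ℕ)
    {M : Type*} [AddCommGroup M] [Module (BigradedRegularity.BiPoly K m n) M]
    [Module.Finite (BigradedRegularity.BiPoly K m n) M]
    (ℳ : ℤ × ℤ → AddSubgroup M) [DirectSum.Decomposition ℳ]
    [SetLike.GradedSMul (BigradedRegularity.polyPart K m n) ℳ]
    (d : ℕ) (p p' : ℤ)
    (h : BigradedRegularity.VC (K := K) (m := m) (n := n) ℳ d p p') :
    Submodule.span (BigradedRegularity.BiPoly K m n)
      (⋃ g ∈ BigradedRegularity.DReg d p p', (ℳ g : Set M)) = ⊤ := by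
  set N := Submodule.span (BiPoly K m n) (⋃ g ∈ DReg d p p', (ℳ g : Set M))
  obtain ⟨t₀, ht₀⟩ := exists_eq_bot_of_total_lt K m n ℳ
  -- The induction starts at total degree `t₀ - 1`, where `M` is zero.
  have key : ∀ l : ℕ, sharp ℳ (t₀ - 1 + l) ≤ N.toAddSubgroup := by
    intro l
    induction l with
    | zero =>
      refine iSup_le fun g => ?_
      have hg := g.2
      rw [ht₀ g.1 (by push_cast at hg; omega)]
      exact bot_le
    | succ l ih =>
      refine iSup_le ?_
      rintro ⟨⟨k, k'⟩, hk⟩ x hx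
      have hk' : k + k' - 1 = t₀ - 1 + l := by
        push_cast at hk
        omega
      by_cases hreg : (k, k') ∈ DReg d p p'
      · exact Submodule.subset_span (Set.mem_biUnion hreg hx)
      · exact h.mem_of_notMem_DReg (hk' ▸ ih) hreg hx
  rw [eq_top_iff]
  rintro x -
  induction x using DirectSum.Decomposition.inductionOn ℳ with
  | zero => exact N.zero_mem
  | @homogeneous g x =>
    by_cases hg : g.1 + g.2 < t₀
    · rw [(AddSubgroup.eq_bot_iff_forall _).1 (ht₀ g hg) x x.2]
      exact N.zero_mem
    · refine key (g.1 + g.2 - (t₀ - 1)).toNat ?_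
      rw [Int.toNat_of_nonneg (by omega), add_sub_cancel]
      exact AddSubgroup.mem_iSup_of_mem
        (S := fun h : {h : ℤ × ℤ // h.1 + h.2 = g.1 + g.2} => ℳ h.1) ⟨g, rfl⟩ x.2
  | add x y hx hy => exact N.add_mem hx hy
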